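/- **Theorem 3.3.** All topological spaces are assumed Hausdorff. A topological group $G$ is called *feathered* if it contains a non-empty compact set $K$ of countable character in $G$, that is, there is a countable family $\mathcal{B}$ of open sets containing $K$ such that every open set containing $K$ contains a member of $\mathcal{B}$. It is called *$\mathcal{M}$-factorizable* if for every continuous function $f:G\to\mathbb{R}$ there are a continuous homomorphism $\varphi:G\to H$ onto a metrizable topological group $H$ and a continuous function $g:H\to\mathbb{R}$ such that $f=g\circ\varphi$. It is called *$P\mathcal{M}$-factorizable* if for every continuous function $f:G\to\mathbb{R}$ there are a perfect homomorphism $\pi:G\to H$ (that is, a homomorphism which is a continuous closed surjection with compact fibers $\pi^{-1}(y)$, $y\in H$) onto a metrizable topological group $H$ and a continuous function $g:H\to\mathbb{R}$ such that $f=g\circ\pi$. Let $G$ be a Hausdorff topological group. Then $G$ is $P\mathcal{M}$-factorizable if and only if $G$ is feathered and $\mathcal{M}$-factorizable. -/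

import Mathlib

open Set TopologicalSpace

universe u

/-- A perfect mapping: a continuous closed surjection with compact fibers. -/
structure IsPerfectMap {X Y : Type*} [TopologicalSpace X] [TopologicalSpace Y]
    (f : X → Y) : Prop where
  continuous : Continuous f
  isClosedMap : IsClosedMap f
  surjective : Function.Surjective f
  isCompact_fiber : ∀ y : Y, IsCompact (f ⁻¹' {y})

/-- A subset `K` of `X` has countable character in `X`: there is a countable family of open
sets containing `K` such that every open set containing `K` contains a member of the family. -/
def HasCountableCharacter {X : Type*} [TopologicalSpace X] (K : Set X) : Prop :=
  ∃ B : Set (Set X), B.Countable ∧ (∀ U ∈ B, IsOpen U ∧ K ⊆ U) ∧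
    ∀ O : Set X, IsOpen O → K ⊆ O → ∃ U ∈ B, U ⊆ O

/-- A feathered space (used for topological groups): it contains a non-empty compact set of
countable character. -/
def IsFeathered (G : Type*) [TopologicalSpace G] : Prop :=
  ∃ K : Set G, K.Nonempty ∧ IsCompact K ∧ HasCountableCharacter K

/-- `G` is `M`-factorizable: every continuous real-valued function on `G` factors through a
continuous homomorphism onto a metrizable topological group. Since the homomorphism is onto,
it is no restriction to take the metrizable group in the universe of `G`. -/
def IsMFactorizable (G : Type u) [TopologicalSpace G] [Group G] : Prop :=
  ∀ f : G → ℝ, Continuous f →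
    ∃ (H : Type u) (_ : TopologicalSpace H) (_ : Group H),
      IsTopologicalGroup H ∧ MetrizableSpace H ∧
      ∃ φ : G →* H, Continuous φ ∧ Function.Surjective φ ∧
        ∃ g : H → ℝ, Continuous g ∧ f = g ∘ φ

/-- `G` is `PM`-factorizable: every continuous real-valued function on `G` factors through a
perfect homomorphism onto a metrizable topological group. -/
def IsPMFactorizable (G : Type u) [TopologicalSpace G] [Group G] : Prop :=
  ∀ f : G → ℝ, Continuous f →
    ∃ (H : Type u) (_ : TopologicalSpace H) (_ : Group H),
      IsTopologicalGroup H ∧ MetrizableSpace H ∧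
      ∃ π : G →* H, IsPerfectMap π ∧
        ∃ g : H → ℝ, Continuous g ∧ f = g ∘ π

/-! The substance is that feathered and `M`-factorizable give `PM`-factorizable. Countable character
of the compact set `K` is encoded in one continuous function `h`, zero on `K`, whose sublevel sets
shrink to `K`. Factor `f` and `h` through a common `φ`. The fibre through a point of `K` lies in the
zero set of `h`, hence in `K`, so it is compact; the sublevel sets make `φ` closed there, and
translations carry both properties to every fibre. Conversely, a fibre of a perfect map over a point
with a countable base is compact of countable character. -/

/-- In a completely regular space, a compact set and the complement of an open neighbourhood of it
are separated by a continuous function to `[0, 1]`. -/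
theorem exists_continuous_zero_on_isCompact_one_off_isOpen {X : Type*} [TopologicalSpace X]
    [CompletelyRegularSpace X] {K O : Set X} (hK : IsCompact K) (hO : IsOpen O) (hKO : K ⊆ O) :
    ∃ f : X → ℝ, Continuous f ∧ (∀ x, f x ∈ Icc (0 : ℝ) 1) ∧ (∀ x ∈ K, f x = 0) ∧
      ∀ x ∉ O, f x = 1 := by
  refine hK.induction_on (p := fun s => ∃ f : X → ℝ, Continuous f ∧ (∀ x, f x ∈ Icc (0 : ℝ) 1) ∧
      (∀ x ∈ s, f x = 0) ∧ ∀ x ∉ O, f x = 1) ?_ ?_ ?_ ?_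
  · exact ⟨fun _ => 1, continuous_const, by simp, by simp, by simp⟩
  · rintro s t hst ⟨f, hf, hf01, hf0, hf1⟩
    exact ⟨f, hf, hf01, fun x hx => hf0 x (hst hx), hf1⟩
  · rintro s t ⟨f, hf, hf01, hf0, hf1⟩ ⟨g, hg, hg01, hg0, hg1⟩
    refine ⟨fun x => f x * g x, hf.mul hg, fun x => ⟨mul_nonneg (hf01 x).1 (hg01 x).1,
      mul_le_one₀ (hf01 x).2 (hg01 x).1 (hg01 x).2⟩, ?_, fun x hx => by simp [hf1 x hx, hg1 x hx]⟩
    rintro x (hx | hx)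
    · simp [hf0 x hx]
    · simp [hg0 x hx]
  · intro x hx
    obtain ⟨f, hf, hfx, hf1⟩ := CompletelyRegularSpace.completely_regular_isOpen x O hO (hKO hx)
    have hf' : Continuous fun y => (f y : ℝ) := continuous_subtype_val.comp hf
    -- Truncating and rescaling makes the function vanish on a whole neighbourhood of `x`, as the
    -- compactness induction needs.
    refine ⟨{y | (f y : ℝ) < 1 / 2}, mem_nhdsWithin_of_mem_nhds
      ((isOpen_lt hf' continuous_const).mem_nhds (by simp [hfx])),
      fun y => max 0 (2 * f y - 1), by fun_prop, fun y => ⟨le_max_left _ _, ?_⟩, ?_, ?_⟩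
    · have := (f y).2.2
      exact max_le zero_le_one (by linarith)
    · intro y hy
      have : (f y : ℝ) < 1 / 2 := hy
      exact max_eq_left (by linarith)
    · intro y hy
      have : f y = 1 := hf1 hy
      norm_num [this]

/-- A compact set of countable character in a completely regular space admits a
continuous function vanishing on it whose small sublevel sets form a neighbourhood base of it. -/
theorem HasCountableCharacter.exists_continuous_sublevel_basis {X : Type*} [TopologicalSpace X]
    [CompletelyRegularSpace X] {K : Set X} (hK : IsCompact K) (hc : HasCountableCharacter K) :
    ∃ h : X → ℝ, Continuous h ∧ (∀ x ∈ K, h x = 0) ∧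
      ∀ O : Set X, IsOpen O → K ⊆ O → ∃ ε > 0, {x | h x < ε} ⊆ O := by
  obtain ⟨B, hBc, hB, hbase⟩ := hc
  obtain ⟨U, hU, -⟩ := hbase univ isOpen_univ (subset_univ K)
  obtain ⟨b, rfl⟩ := hBc.exists_eq_range ⟨U, hU⟩
  choose f hf hf01 hf0 hf1 using fun n => exists_continuous_zero_on_isCompact_one_off_isOpen hK
    (hB (b n) (mem_range_self n)).1 (hB (b n) (mem_range_self n)).2
  have hsum : Summable fun n : ℕ => (1 / 2 : ℝ) ^ n := summable_geometric_two
  have hnonneg : ∀ n x, 0 ≤ (1 / 2 : ℝ) ^ n * f n x := fun n x =>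
    mul_nonneg (by positivity) (hf01 n x).1
  have hle : ∀ n x, (1 / 2 : ℝ) ^ n * f n x ≤ (1 / 2) ^ n := fun n x =>
    mul_le_of_le_one_right (by positivity) (hf01 n x).2
  refine ⟨fun x => ∑' n, (1 / 2 : ℝ) ^ n * f n x, continuous_tsum
    (fun n => continuous_const.mul (hf n)) hsum fun n x => ?_, fun x hx => ?_, fun O hO hKO => ?_⟩
  · rw [Real.norm_of_nonneg (hnonneg n x)]
    exact hle n x
  · simp [hf0 _ x hx]
  · obtain ⟨_, ⟨n, rfl⟩, hn⟩ := hbase O hO hKO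
    -- Off `b n` the `n`-th term alone already equals `(1 / 2) ^ n`.
    refine ⟨(1 / 2) ^ n, by positivity, fun x hx => hn ?_⟩
    by_contra hxn
    have hterm := (Summable.of_nonneg_of_le (fun n => hnonneg n x) (fun n => hle n x) hsum).le_tsum n
      fun m _ => hnonneg m x
    rw [hf1 n x hxn, mul_one] at hterm
    exact hterm.not_gt hx

/-- A map to a Hausdorff space through which a function with sublevel sets shrinking to a compact
set `K` factors is closed at every point whose fibre meets `K`. -/
theorem exists_nhds_preimage_subset_of_sublevel_basis {X Y : Type*} [TopologicalSpace X]
    [TopologicalSpace Y] [T2Space Y] {φ : X → Y} (hφ : Continuous φ) {g : Y → ℝ}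
    (hg : Continuous g) {K : Set X} (hK : IsCompact K)
    (hbase : ∀ O : Set X, IsOpen O → K ⊆ O → ∃ ε > 0, {x | g (φ x) < ε} ⊆ O)
    {y : Y} (hy : g y = 0) {O : Set X} (hO : IsOpen O) (hfib : φ ⁻¹' {y} ⊆ O) :
    ∃ V ∈ nhds y, φ ⁻¹' V ⊆ O := by
  have hdisj : Disjoint {y} (φ '' (K \ O)) := by
    rw [disjoint_singleton_left]
    rintro ⟨x, hx, hxy⟩
    exact hx.2 (hfib hxy)
  obtain ⟨V, W, hV, hW, hyV, hKW, hVW⟩ :=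
    SeparatedNhds.of_isCompact_isCompact isCompact_singleton ((hK.diff hO).image hφ) hdisj
  -- Points of a small sublevel set lie in `O` or over `W`; those over `V` avoid `W`, so they lie in
  -- `O`.
  obtain ⟨ε, hε, hsub⟩ := hbase (O ∪ φ ⁻¹' W) (hO.union (hW.preimage hφ)) fun x hx => by
    by_cases hxO : x ∈ O
    · exact Or.inl hxO
    · exact Or.inr (hKW ⟨x, ⟨hx, hxO⟩, rfl⟩)
  refine ⟨V ∩ {z | g z < ε}, Filter.inter_mem (hV.mem_nhds (hyV rfl))
    ((isOpen_lt hg continuous_const).mem_nhds (by simpa [hy] using hε)), fun x hx => ?_⟩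
  exact (hsub hx.2).resolve_right fun hxW => disjoint_left.mp hVW hx.1 hxW

/-- A continuous surjective homomorphism is perfect if one fibre is compact and the map is closed
at that fibre. -/
theorem MonoidHom.isPerfectMap_of_fiber {G H : Type*} [TopologicalSpace G] [Group G]
    [IsTopologicalGroup G] [TopologicalSpace H] [Group H] [IsTopologicalGroup H] {φ : G →* H}
    (hφ : Continuous φ) (hsurj : Function.Surjective φ) {y : H} (hcomp : IsCompact (φ ⁻¹' {y}))
    (hclosed : ∀ O : Set G, IsOpen O → φ ⁻¹' {y} ⊆ O → ∃ V ∈ nhds y, φ ⁻¹' V ⊆ O) :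
    IsPerfectMap φ := by
  have htrans : ∀ z : H, ∃ a : G, φ a * y = z := fun z => by
    obtain ⟨a, ha⟩ := hsurj (z * y⁻¹)
    exact ⟨a, by simp [ha]⟩
  refine ⟨hφ, ?_, hsurj, fun z => ?_⟩
  · rw [isClosedMap_iff_kernImage]
    intro O hO
    rw [isOpen_iff_mem_nhds]
    intro z hz
    obtain ⟨a, rfl⟩ := htrans z
    obtain ⟨V, hV, hVO⟩ := hclosed ((fun x => a * x) ⁻¹' O) (hO.preimage (continuous_const_mul a))
      fun x hx => hz (by simpa using hx)
    have hV' : (fun w => (φ a)⁻¹ * w) ⁻¹' V ∈ nhds (φ a * y) :=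
      (continuous_const_mul (φ a)⁻¹).continuousAt.preimage_mem_nhds (by simpa using hV)
    filter_upwards [hV'] with w hw x hx
    have hxO : a⁻¹ * x ∈ (fun x => a * x) ⁻¹' O := hVO (by simpa [← hx] using hw)
    simpa using hxO
  · obtain ⟨a, rfl⟩ := htrans z
    convert hcomp.image (continuous_const_mul a) using 1
    ext x
    simp [inv_mul_eq_iff_eq_mul]

/-- A space admitting a perfect map onto a nonempty first countable space is feathered. -/
theorem IsPerfectMap.isFeathered {X Y : Type*} [TopologicalSpace X] [TopologicalSpace Y]
    [FirstCountableTopology Y] [Nonempty Y] {π : X → Y} (hπ : IsPerfectMap π) :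
    IsFeathered X := by
  obtain ⟨y⟩ := ‹Nonempty Y›
  obtain ⟨x, hx⟩ := hπ.surjective y
  obtain ⟨b, hb, hbasis⟩ := (nhds_basis_opens y).exists_antitone_subbasis
  refine ⟨π ⁻¹' {y}, ⟨x, hx⟩, hπ.isCompact_fiber y, range fun n => π ⁻¹' b n,
    countable_range _, ?_, fun O hO hfib => ?_⟩
  · rintro _ ⟨n, rfl⟩
    exact ⟨(hb n).2.preimage hπ.continuous, preimage_mono (singleton_subset_iff.2 (hb n).1)⟩
  · have hker := isClosedMap_iff_kernImage.1 hπ.isClosedMap hO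
    obtain ⟨n, -, hn⟩ := hbasis.1.mem_iff.1 (hker.mem_nhds fun z hz => hfib hz)
    exact ⟨_, ⟨n, rfl⟩, fun z hz => hn hz rfl⟩

theorem IsPMFactorizable.isMFactorizable {G : Type u} [TopologicalSpace G] [Group G]
    (hG : IsPMFactorizable G) : IsMFactorizable G := fun f hf => by
  obtain ⟨H, hHt, hHg, hH, hHm, π, hπ, g, hg, hfg⟩ := hG f hf
  exact ⟨H, hHt, hHg, hH, hHm, π, hπ.continuous, hπ.surjective, g, hg, hfg⟩

theorem IsPMFactorizable.isFeathered {G : Type u} [TopologicalSpace G] [Group G]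
    (hG : IsPMFactorizable G) : IsFeathered G := by
  obtain ⟨H, _, _, _, _, π, hπ, -⟩ := hG (fun _ => 0) continuous_const
  exact hπ.isFeathered

/-- In an `M`-factorizable group, two continuous functions factor through a common homomorphism. -/
theorem IsMFactorizable.exists_common_factorization {G : Type u} [TopologicalSpace G] [Group G]
    (hG : IsMFactorizable G) {f₁ f₂ : G → ℝ} (hf₁ : Continuous f₁) (hf₂ : Continuous f₂) :
    ∃ (H : Type u) (_ : TopologicalSpace H) (_ : Group H),
      IsTopologicalGroup H ∧ MetrizableSpace H ∧
      ∃ φ : G →* H, Continuous φ ∧ Function.Surjective φ ∧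
        ∃ g₁ g₂ : H → ℝ, Continuous g₁ ∧ Continuous g₂ ∧ f₁ = g₁ ∘ φ ∧ f₂ = g₂ ∘ φ := by
  obtain ⟨H₁, _, _, _, _, φ₁, hφ₁, -, g₁, hg₁, hfg₁⟩ := hG f₁ hf₁
  obtain ⟨H₂, _, _, _, _, φ₂, hφ₂, -, g₂, hg₂, hfg₂⟩ := hG f₂ hf₂
  -- Passing to the range in `H₁ × H₂` restores surjectivity and keeps metrizability.
  refine ⟨(φ₁.prod φ₂).range, inferInstance, inferInstance, inferInstance,
    Topology.IsEmbedding.subtypeVal.metrizableSpace,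
    (φ₁.prod φ₂).rangeRestrict, (hφ₁.prodMk hφ₂).subtype_mk _, MonoidHom.rangeRestrict_surjective _,
    fun z => g₁ z.1.1, fun z => g₂ z.1.2, by fun_prop, by fun_prop, hfg₁, hfg₂⟩

theorem IsMFactorizable.isPMFactorizable {G : Type u} [TopologicalSpace G] [Group G]
    [IsTopologicalGroup G] [T2Space G] (hG : IsMFactorizable G) (hfeath : IsFeathered G) :
    IsPMFactorizable G := by
  intro f hf
  obtain ⟨K, ⟨k, hk⟩, hK, hchar⟩ := hfeath
  have : CompletelyRegularSpace G :=
    .of_exists_uniformSpace ⟨IsTopologicalGroup.rightUniformSpace G, rfl⟩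
  obtain ⟨h, hh, hhK, hbase⟩ := hchar.exists_continuous_sublevel_basis hK
  obtain ⟨H, hHt, hHg, hH, hHm, φ, hφ, hsurj, g, g', hg, hg', hfg, rfl⟩ :=
    hG.exists_common_factorization hf hh
  have hfib : φ ⁻¹' {φ k} ⊆ K := fun x hx => by
    by_contra hxK
    -- A zero of `g' ∘ φ` lies in every sublevel set, but some sublevel set avoids a given `x ∉ K`.
    obtain ⟨ε, hε, hsub⟩ := hbase {x}ᶜ isOpen_compl_singleton fun z hz hzx => hxK (hzx ▸ hz)
    have hx0 : g' (φ x) = 0 := by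
      rw [show φ x = φ k from hx]
      exact hhK k hk
    exact hsub (show (g' ∘ φ) x < ε by simpa [hx0] using hε) rfl
  exact ⟨H, hHt, hHg, hH, hHm, φ, MonoidHom.isPerfectMap_of_fiber hφ hsurj
    (hK.of_isClosed_subset (isClosed_singleton.preimage hφ) hfib)
    fun O hO hO' => exists_nhds_preimage_subset_of_sublevel_basis hφ hg' hK hbase (hhK k hk) hO hO',
    g, hg, hfg⟩

theorem theorem3p3 (G : Type u) [TopologicalSpace G] [Group G] [IsTopologicalGroup G]
    [T2Space G] :
    IsPMFactorizable G ↔ IsFeathered G ∧ IsMFactorizable G :=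
  ⟨fun h => ⟨h.isFeathered, h.isMFactorizable⟩, fun h => h.2.isPMFactorizable h.1⟩
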